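/- Let $\gamma\ge 0$, let $N\ge 2$ be an integer, and let $\beta_1,\dots,\beta_N>0$ with $\beta_1+\dots+\beta_N=2\pi$ (so $\beta_N=2\pi-\sum_{i<N}\beta_i$ is determined by $\beta=(\beta_1,\dots,\beta_{N-1})$). Put $\vartheta_0=0$, $\vartheta_k=\beta_1+\dots+\beta_k$, let $L_k$ be the half-line in $\mathbb R^2$ from the origin with polar angle $\vartheta_k$, and let $\Gamma(\beta)=\bigcup_{k=0}^{N-1}L_k$ be the star graph with $N$ arms. Let $m$ be the arc-length measure on $\Gamma(\beta)$ and let $I_m:H^1(\mathbb R^2)\to L^2(m)$ be the bounded linear map with $I_m\psi=\psi$ for all Schwartz functions $\psi$. Let $H_N(\beta)$ be the self-adjoint operator in $L^2(\mathbb R^2)$, bounded from below, associated with the closed form $$q(\psi,\phi)=\int_{\mathbb R^2}\nabla\bar\psi\cdot\nabla\phi\,dx-\gamma\int_{\Gamma(\beta)}\overline{I_m\psi}\,I_m\phi\,dm,\qquad D(q)=H^1(\mathbb R^2).$$ Let $1\le j\le N$, let $\tilde\beta_j^{(1)},\tilde\beta_j^{(2)}>0$ with $\tilde\beta_j^{(1)}+\tilde\beta_j^{(2)}=\beta_j$,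 and let $\tilde\beta$ be the sequence of $N+1$ angles $\beta_1,\dots,\beta_{j-1},\tilde\beta_j^{(1)},\tilde\beta_j^{(2)},\beta_{j+1},\dots,\beta_N$, with star-graph operator $H_{N+1}(\tilde\beta)$ (same $\gamma$). Then $$H_N(\beta)\ \ge\ H_{N+1}(\tilde\beta)$$ in the sense of forms: $H_N(\beta)$ and $H_{N+1}(\tilde\beta)$ are the operators associated with densely defined, closed, symmetric forms $t$ and $s$ bounded from below such that $D(t)\subseteq D(s)$ and $t[\psi]\ge s[\psi]$ for all $\psi\in D(t)$. -/

import Mathlib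

open MeasureTheory LineDeriv
open scoped SchwartzMap ENNReal InnerProductSpace

noncomputable section

/-! ### Sesquilinear forms in a Hilbert space, associated operators, order in the form sense -/

/-- A sesquilinear form in a complex Hilbert space, defined on a linear subspace
(antilinear in the first and linear in the second argument). -/
structure SesqForm (E : Type*) [NormedAddCommGroup E] [InnerProductSpace ℂ E] where
  /-- The domain of the form. -/
  domain : Submodule ℂ E
  /-- The values of the form. -/
  form : domain →ₗ⋆[ℂ] domain →ₗ[ℂ] ℂ

namespace SesqForm

variable {E : Type*} [NormedAddCommGroup E] [InnerProductSpace ℂ E]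

/-- The (real) value `q[ψ] = q(ψ, ψ)` of a symmetric form. -/
def quad (q : SesqForm E) (ψ : q.domain) : ℝ := (q.form ψ ψ).re

/-- Densely defined, symmetric, bounded from below and closed: these are the forms to which the
first representation theorem associates a self-adjoint operator that is bounded from below. -/
structure IsClosedSemibounded (q : SesqForm E) : Prop where
  dense : Dense (q.domain : Set E)
  symm : ∀ φ ψ : q.domain, q.form φ ψ = (starRingEnd ℂ) (q.form ψ φ)
  bounded_below : ∃ c : ℝ, ∀ ψ : q.domain, c * ‖(ψ : E)‖ ^ 2 ≤ q.quad ψ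
  /-- If `ψₙ → ψ` in the Hilbert space and `q[ψₙ - ψₘ] → 0`, then `ψ` lies in the domain and
  `q[ψₙ - ψ] → 0`. -/
  closed : ∀ (u : ℕ → q.domain) (ψ : E),
    Filter.Tendsto (fun n => (u n : E)) Filter.atTop (nhds ψ) →
    Filter.Tendsto (fun p : ℕ × ℕ => q.quad (u p.1 - u p.2)) Filter.atTop (nhds 0) →
    ∃ h : ψ ∈ q.domain,
      Filter.Tendsto (fun n => q.quad (u n - ⟨ψ, h⟩)) Filter.atTop (nhds 0)

/-- The graph of the operator associated with `q`: the pairs `(ψ, χ)` with `ψ` in the domain of `q`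
and `q(φ, ψ) = ⟪φ, χ⟫` for all `φ` in the domain of `q`. -/
def operatorGraph (q : SesqForm E) : Submodule ℂ (E × E) where
  carrier := {p | ∃ h : p.1 ∈ q.domain,
    ∀ φ : q.domain, q.form φ ⟨p.1, h⟩ = ⟪(φ : E), p.2⟫_ℂ}
  zero_mem' := ⟨q.domain.zero_mem, fun φ => by
    have h0 : (⟨(0 : E × E).1, q.domain.zero_mem⟩ : q.domain) = 0 := rfl
    rw [h0]; simp⟩
  add_mem' := by
    rintro a b ⟨ha, ha'⟩ ⟨hb, hb'⟩
    refine ⟨q.domain.add_mem ha hb, fun φ => ?_⟩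
    have h0 : (⟨(a + b).1, q.domain.add_mem ha hb⟩ : q.domain) = ⟨a.1, ha⟩ + ⟨b.1, hb⟩ := rfl
    rw [h0, map_add, ha' φ, hb' φ, Prod.snd_add, inner_add_right]
  smul_mem' := by
    rintro c a ⟨ha, ha'⟩
    refine ⟨q.domain.smul_mem c ha, fun φ => ?_⟩
    have h0 : (⟨(c • a).1, q.domain.smul_mem c ha⟩ : q.domain) = c • ⟨a.1, ha⟩ := rfl
    rw [h0, map_smul, ha' φ, Prod.smul_snd, inner_smul_right, smul_eq_mul]

/-- The operator associated with `q`. (When the domain of `q` is dense, `operatorGraph q` is the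
graph of an operator and this is that operator.) -/
def operator (q : SesqForm E) : E →ₗ.[ℂ] E := q.operatorGraph.toLinearPMap

end SesqForm

/-- `T ≥ S` in the sense of forms, for operators `T`, `S` bounded from below and self-adjoint:
`T` and `S` are the operators associated with densely defined closed symmetric forms `t`, `s`
bounded from below (these forms are uniquely determined by `T` and `S`), the domain of `t` is
contained in that of `s`, and `t[ψ] ≥ s[ψ]` for every `ψ` in the domain of `t`. -/
def FormGE {E : Type*} [NormedAddCommGroup E] [InnerProductSpace ℂ E] (T S : E →ₗ.[ℂ] E) : Prop :=
  ∃ t s : SesqForm E, t.IsClosedSemibounded ∧ s.IsClosedSemibounded ∧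
    t.operator = T ∧ s.operator = S ∧
    ∃ h : t.domain ≤ s.domain,
      ∀ ψ : t.domain, s.quad (Submodule.inclusion h ψ) ≤ t.quad ψ

/-! ### The Sobolev space `H¹(ℝ²)` -/

/-- The Euclidean plane. -/
abbrev Plane : Type := EuclideanSpace ℝ (Fin 2)

/-- The Hilbert space `L²(ℝ²)`. -/
abbrev L2Plane : Type := Lp ℂ 2 (volume : Measure Plane)

/-- The `i`-th standard basis vector of the plane. -/
def planeBasis (i : Fin 2) : Plane := EuclideanSpace.single i 1

/-- `H¹(ℝ²)`, realised as the space of pairs `(ψ, ∇ψ)` where `ψ ∈ L²(ℝ²)` and the distributional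
gradient `∇ψ` lies in `L²(ℝ²)²`. Its norm is `(‖ψ‖² + ‖∂₁ψ‖² + ‖∂₂ψ‖²)^(1/2)`. -/
def sobolevH1 : Submodule ℂ (WithLp 2 (L2Plane × PiLp 2 (fun _ : Fin 2 => L2Plane))) where
  carrier := {p | ∀ i : Fin 2,
    ∂_{planeBasis i} (Lp.toTemperedDistribution p.fst) = Lp.toTemperedDistribution (p.snd i)}
  zero_mem' := fun i => by
    simp only [← Lp.toTemperedDistributionCLM_apply, WithLp.zero_fst, WithLp.zero_snd,
      PiLp.zero_apply, map_zero, lineDerivOp_zero]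
  add_mem' := fun {a b} ha hb i => by
    have h1 := ha i
    have h2 := hb i
    simp only [← Lp.toTemperedDistributionCLM_apply] at h1 h2 ⊢
    simp only [WithLp.add_fst, WithLp.add_snd, PiLp.add_apply, map_add, lineDerivOp_add, h1, h2]
  smul_mem' := fun c a ha i => by
    have h1 := ha i
    simp only [← Lp.toTemperedDistributionCLM_apply] at h1 ⊢
    simp only [WithLp.smul_fst, WithLp.smul_snd, PiLp.smul_apply, map_smul, lineDerivOp_smul, h1]

/-- The inclusion `H¹(ℝ²) → L²(ℝ²)`. -/
def sobolevH1.toL2 : sobolevH1 →ₗ[ℂ] L2Plane where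
  toFun ψ := (ψ : WithLp 2 (L2Plane × PiLp 2 (fun _ : Fin 2 => L2Plane))).fst
  map_add' _ _ := rfl
  map_smul' _ _ := rfl

/-- The gradient `H¹(ℝ²) → L²(ℝ²)²`. -/
def sobolevH1.grad : sobolevH1 →ₗ[ℂ] PiLp 2 (fun _ : Fin 2 => L2Plane) where
  toFun ψ := (ψ : WithLp 2 (L2Plane × PiLp 2 (fun _ : Fin 2 => L2Plane))).snd
  map_add' _ _ := rfl
  map_smul' _ _ := rfl

/-- The gradient is determined by the function. -/
theorem sobolevH1.toL2_injective : Function.Injective sobolevH1.toL2 := by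
  rw [← LinearMap.ker_eq_bot, LinearMap.ker_eq_bot']
  rintro ⟨p, hp⟩ h
  have h1 : p.fst = 0 := h
  have h2 : ∀ i, p.snd i = 0 := fun i => by
    have h3 := hp i
    rw [h1] at h3
    simp only [← Lp.toTemperedDistributionCLM_apply, map_zero, lineDerivOp_zero] at h3
    exact LinearMap.ker_eq_bot'.mp (Lp.ker_toTemperedDistributionCLM_eq_bot
      (F := ℂ) (μ := (volume : Measure Plane)) (p := 2)) _ h3.symm
  apply Subtype.ext
  apply (WithLp.equiv 2 _).injective
  exact Prod.ext h1 (PiLp.ext h2)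

/-- The inclusion of the Schwartz space into `H¹(ℝ²)`. -/
def schwartzToH1 : 𝓢(Plane, ℂ) →ₗ[ℂ] sobolevH1 where
  toFun f := ⟨WithLp.toLp 2 (f.toLp 2 volume,
      WithLp.toLp 2 fun i => (∂_{planeBasis i} f : 𝓢(Plane, ℂ)).toLp 2 volume), fun i => by
    change ∂_{planeBasis i} (Lp.toTemperedDistribution (f.toLp 2 volume)) =
      Lp.toTemperedDistribution ((∂_{planeBasis i} f : 𝓢(Plane, ℂ)).toLp 2 volume)
    rw [Lp.toTemperedDistribution_toLp_eq, Lp.toTemperedDistribution_toLp_eq,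
      TemperedDistribution.lineDerivOp_toTemperedDistributionCLM_eq]⟩
  map_add' f g := by
    apply Subtype.ext
    apply (WithLp.equiv 2 _).injective
    refine Prod.ext rfl (PiLp.ext fun i => ?_)
    change (∂_{planeBasis i} (f + g) : 𝓢(Plane, ℂ)).toLp 2 volume = _
    rw [lineDerivOp_add]
    rfl
  map_smul' c f := by
    apply Subtype.ext
    apply (WithLp.equiv 2 _).injective
    refine Prod.ext rfl (PiLp.ext fun i => ?_)
    change (∂_{planeBasis i} (c • f) : 𝓢(Plane, ℂ)).toLp 2 volume = _
    rw [lineDerivOp_smul]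
    rfl

/-! ### Schrödinger operators `-Δ - γ m` with a singular interaction -/

/-- The bounded map `I_m : H¹(ℝ²) → L²(m)` with `I_m ψ = ψ` for every Schwartz function `ψ`,
obtained by continuous extension from the dense subspace of Schwartz functions. -/
def sobolevTrace (m : Measure Plane) [m.HasTemperateGrowth] : sobolevH1 →L[ℂ] Lp ℂ 2 m :=
  LinearMap.extendOfNorm (SchwartzMap.toLpCLM ℂ ℂ 2 m : 𝓢(Plane, ℂ) →L[ℂ] Lp ℂ 2 m).toLinearMap
    schwartzToH1

/-- The form `(ψ, φ) ↦ ∫ ∇ψ̄ · ∇φ dx - γ ∫ (I_m ψ)‾ (I_m φ) dm` as a function on `H¹ × H¹`. -/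
def schrodingerSesq (γ : ℝ) (m : Measure Plane) [m.HasTemperateGrowth] :
    sobolevH1 →ₗ⋆[ℂ] sobolevH1 →ₗ[ℂ] ℂ :=
  LinearMap.mk₂'ₛₗ (starRingEnd ℂ) (RingHom.id ℂ)
    (fun ψ φ => ⟪sobolevH1.grad ψ, sobolevH1.grad φ⟫_ℂ
      - (γ : ℂ) * ⟪sobolevTrace m ψ, sobolevTrace m φ⟫_ℂ)
    (fun a b c => by simp only [map_add, inner_add_left]; ring)
    (fun c a b => by simp only [map_smul, inner_smul_left, smul_eq_mul]; ring)
    (fun a b c => by simp only [map_add, inner_add_right]; ring)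
    (fun c a b => by
      simp only [map_smul, inner_smul_right, smul_eq_mul, RingHom.id_apply]; ring)

/-- The form `q_{γ m}` in `L²(ℝ²)`, with domain `H¹(ℝ²)`. -/
def schrodingerForm (γ : ℝ) (m : Measure Plane) [m.HasTemperateGrowth] : SesqForm L2Plane where
  domain := LinearMap.range sobolevH1.toL2
  form :=
    let e := (LinearEquiv.ofInjective sobolevH1.toL2 sobolevH1.toL2_injective).symm.toLinearMap
    ((schrodingerSesq γ m).comp e).compl₂ e

/-! ### Star graphs -/

/-- The unit vector of polar angle `θ`. -/
def unitVec (θ : ℝ) : Plane := !₂[Real.cos θ, Real.sin θ]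

/-- The arc-length measure on the half-line `{s (cos θ, sin θ) : s > 0}`. -/
def armMeasure (θ : ℝ) : Measure Plane :=
  (volume.restrict (Set.Ioi (0 : ℝ))).map (fun s : ℝ => s • unitVec θ)

/-- The consecutive angles of an `N`-armed star: `N` positive numbers which add up to `2π`. -/
def IsAngleSeq {N : ℕ} (β : Fin N → ℝ) : Prop :=
  (∀ i, 0 < β i) ∧ ∑ i, β i = 2 * Real.pi

/-- The polar angle of the `j`-th arm (`j = 0, …, N - 1`): the sum of the first `j` angles. -/
def armAngle {N : ℕ} (β : Fin N → ℝ) (j : Fin N) : ℝ := ∑ i ∈ Finset.Iio j, β i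

/-- The arc-length measure on the star graph, the union of the `N` half-lines. -/
def starMeasure {N : ℕ} (β : Fin N → ℝ) : Measure Plane := ∑ j, armMeasure (armAngle β j)

theorem norm_unitVec (θ : ℝ) : ‖unitVec θ‖ = 1 := by
  simp [unitVec, EuclideanSpace.norm_eq]

instance starMeasure_hasTemperateGrowth {N : ℕ} (β : Fin N → ℝ) :
    (starMeasure β).HasTemperateGrowth := by
  obtain ⟨n, hn⟩ := Measure.HasTemperateGrowth.exists_integrable (μ := (volume : Measure ℝ))
  refine ⟨n, ?_⟩
  rw [starMeasure, integrable_finsetSum_measure]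
  intro j _
  have hc : Continuous fun x : Plane => (1 + ‖x‖) ^ (-(n : ℝ)) :=
    Continuous.rpow_const (by fun_prop) (fun x => Or.inl (by positivity))
  rw [armMeasure, integrable_map_measure hc.aestronglyMeasurable (by fun_prop)]
  refine (hn.restrict (s := Set.Ioi (0 : ℝ))).congr (Filter.Eventually.of_forall fun s => ?_)
  simp [norm_smul, norm_unitVec]

/-- The star-graph Hamiltonian `H_N(β)` with coupling constant `γ`: the operator associated with
the form `∫ |∇ψ|² dx - γ ∫_Γ |ψ|² ds` on `H¹(ℝ²)`, where `Γ` is the star graph. -/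
def starHamiltonian (γ : ℝ) {N : ℕ} (β : Fin N → ℝ) : L2Plane →ₗ.[ℂ] L2Plane :=
  (schrodingerForm γ (starMeasure β)).operator

end

open MeasureTheory LineDeriv
open scoped SchwartzMap ENNReal InnerProductSpace

noncomputable section

/-! ### The trace inequality for Schwartz functions -/

/-! Splitting an angle inserts one half-line and moves none of the others, so the star measure can
only grow (`starMeasure_mono_of_split`). Hence the trace norm grows on Schwartz functions and, by
density, on all of H¹ (`norm_sobolevTrace_mono`). Both forms have domain H¹ and the same gradient
term, so γ ≥ 0 gives the inequality.

The bulk of the work is to show that the forms are admissible. The trace inequality `‖f‖²_{L²(m)} ≤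
N (ε ‖∇f‖² + ε⁻¹ ‖f‖²)`, with ε free, together with density of the Schwartz functions
(`denseRange_schwartzToH1`), makes `sobolevTrace` a genuine extension. For small ε the interaction
is absorbed into half of the gradient term, so the form is semibounded and controls the H¹ norm up
to the L² norm. Closedness then follows from completeness of H¹. -/

theorem ofReal_sq_norm_le_lintegral_of_hasDerivAt {g g' : ℝ → ℂ}
    (hg : ∀ t, HasDerivAt g (g' t) t) (hg' : Continuous g')
    (h0 : Filter.Tendsto g Filter.atTop (nhds 0)) {ε : ℝ} (hε : 0 < ε) :
    ENNReal.ofReal (‖g 0‖ ^ 2) ≤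
      ∫⁻ t, ENNReal.ofReal (ε * ‖g' t‖ ^ 2 + ε⁻¹ * ‖g t‖ ^ 2) := by
  have hgc : Continuous g := continuous_iff_continuousAt.2 fun t => (hg t).continuousAt
  set k : ℝ → ℝ := fun t => 2 * inner ℝ (g t) (g' t) with hk
  have hkc : Continuous k := by fun_prop
  have hle : ∫⁻ t in Set.Ioi (0 : ℝ), ‖k t‖ₑ ≤
      ∫⁻ t, ENNReal.ofReal (ε * ‖g' t‖ ^ 2 + ε⁻¹ * ‖g t‖ ^ 2) := by
    refine (setLIntegral_le_lintegral _ _).trans (lintegral_mono fun t => ?_)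
    rw [← ofReal_norm]
    refine ENNReal.ofReal_le_ofReal ?_
    have h1 : ‖k t‖ ≤ 2 * (‖g t‖ * ‖g' t‖) := by
      rw [hk, norm_mul, Real.norm_two]
      gcongr
      exact norm_inner_le_norm _ _
    have h2 : 0 ≤ ε⁻¹ * (ε * ‖g' t‖ - ‖g t‖) ^ 2 := by positivity
    have h3 : ε⁻¹ * (ε * ‖g' t‖ - ‖g t‖) ^ 2 =
        ε * ‖g' t‖ ^ 2 + ε⁻¹ * ‖g t‖ ^ 2 - 2 * (‖g t‖ * ‖g' t‖) := by
      field_simp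
      ring
    linarith
  -- If `k` is not integrable, the right-hand side is infinite; otherwise `‖g 0‖²` is minus the
  -- integral of `k = (‖g‖²)'` over the half-line, and `hle` is Young's inequality.
  by_cases hfin : ∫⁻ t in Set.Ioi (0 : ℝ), ‖k t‖ₑ = ⊤
  · rw [hfin, top_le_iff] at hle
    rw [hle]
    exact le_top
  have hint : IntegrableOn k (Set.Ioi 0) :=
    ⟨hkc.aestronglyMeasurable, lt_top_iff_ne_top.2 hfin⟩
  have htend : Filter.Tendsto (fun t => ‖g t‖ ^ 2) Filter.atTop (nhds 0) := by
    simpa using (h0.norm.pow 2)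
  have hI := integral_Ioi_of_hasDerivAt_of_tendsto' (a := 0) (f := fun t => ‖g t‖ ^ 2) (f' := k)
    (fun t _ => (hg t).norm_sq) hint htend
  refine le_trans ?_ hle
  refine le_trans (le_of_eq ?_) (enorm_integral_le_lintegral_enorm _)
  rw [hI, ← ofReal_norm, zero_sub, norm_neg, Real.norm_of_nonneg (by positivity)]

theorem orthonormal_unitVec (θ : ℝ) :
    Orthonormal ℝ ![unitVec θ, unitVec (θ + Real.pi / 2)] := by
  refine ⟨fun i => ?_, fun i j hij => ?_⟩
  · fin_cases i <;> exact norm_unitVec _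
  · fin_cases i <;> fin_cases j <;> simp at hij <;>
      simp [unitVec, PiLp.inner_apply, Fin.sum_univ_two, Real.cos_add_pi_div_two,
        Real.sin_add_pi_div_two, mul_comm]

/-- The orthonormal basis of the plane obtained by rotating the standard one. -/
def rotatedBasis (θ : ℝ) : OrthonormalBasis (Fin 2) ℝ Plane :=
  (basisOfOrthonormalOfCardEqFinrank (orthonormal_unitVec θ) (by simp)).toOrthonormalBasis
    (by simpa using orthonormal_unitVec θ)

theorem measurePreserving_rotatedBasis (θ : ℝ) :
    MeasurePreserving (fun p : ℝ × ℝ => p.1 • unitVec θ + p.2 • unitVec (θ + Real.pi / 2)) := by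
  have h := (rotatedBasis θ).measurePreserving_repr_symm.comp
    ((PiLp.volume_preserving_toLp (Fin 2)).comp (volume_preserving_finTwoArrow ℝ).symm)
  refine (congrArg (MeasurePreserving · volume volume) (funext fun p => ?_)).mp h
  rw [Function.comp_apply, ← OrthonormalBasis.sum_repr_symm]
  simp [rotatedBasis, Fin.sum_univ_two]

/-- Cauchy–Schwarz, with the defect written as a square by Lagrange's identity. -/
theorem sq_norm_lineDerivOp_unitVec_le (f : 𝓢(Plane, ℂ)) (θ : ℝ) (x : Plane) :
    ‖(∂_{unitVec θ} f : 𝓢(Plane, ℂ)) x‖ ^ 2 ≤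
      ‖(∂_{planeBasis 0} f : 𝓢(Plane, ℂ)) x‖ ^ 2 + ‖(∂_{planeBasis 1} f : 𝓢(Plane, ℂ)) x‖ ^ 2 := by
  have h : unitVec θ = Real.cos θ • planeBasis 0 + Real.sin θ • planeBasis 1 := by
    ext i
    fin_cases i <;> simp [unitVec, planeBasis]
  simp only [SchwartzMap.lineDerivOp_apply_eq_fderiv, h, map_add, map_smul]
  set a := fderiv ℝ f x (planeBasis 0)
  set b := fderiv ℝ f x (planeBasis 1)
  have h1 : ‖Real.cos θ • a + Real.sin θ • b‖ ≤ |Real.cos θ| * ‖a‖ + |Real.sin θ| * ‖b‖ := by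
    refine (norm_add_le _ _).trans (le_of_eq ?_)
    rw [norm_smul, norm_smul, Real.norm_eq_abs, Real.norm_eq_abs]
  have h2 : |Real.cos θ| ^ 2 + |Real.sin θ| ^ 2 = 1 := by
    rw [sq_abs, sq_abs, Real.cos_sq_add_sin_sq]
  calc ‖Real.cos θ • a + Real.sin θ • b‖ ^ 2
      ≤ (|Real.cos θ| * ‖a‖ + |Real.sin θ| * ‖b‖) ^ 2 := by gcongr
    _ = (|Real.cos θ| ^ 2 + |Real.sin θ| ^ 2) * (‖a‖ ^ 2 + ‖b‖ ^ 2) -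
        (|Real.cos θ| * ‖b‖ - |Real.sin θ| * ‖a‖) ^ 2 := by ring
    _ ≤ _ := by rw [h2, one_mul]; linarith [sq_nonneg (|Real.cos θ| * ‖b‖ - |Real.sin θ| * ‖a‖)]

/-- The density of `ε ‖∇f‖² + ε⁻¹ ‖f‖²`. -/
def energyDensity (ε : ℝ) (f : 𝓢(Plane, ℂ)) (x : Plane) : ℝ :=
  ε * (‖(∂_{planeBasis 0} f : 𝓢(Plane, ℂ)) x‖ ^ 2 + ‖(∂_{planeBasis 1} f : 𝓢(Plane, ℂ)) x‖ ^ 2)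
    + ε⁻¹ * ‖f x‖ ^ 2

theorem continuous_energyDensity (ε : ℝ) (f : 𝓢(Plane, ℂ)) : Continuous (energyDensity ε f) := by
  have h0 := (∂_{planeBasis 0} f : 𝓢(Plane, ℂ)).continuous
  have h1 := (∂_{planeBasis 1} f : 𝓢(Plane, ℂ)).continuous
  have h2 := f.continuous
  unfold energyDensity
  fun_prop

/-- In coordinates `(s, t)` along and perpendicular to the arm, the arm lies in `t = 0`. The
one-dimensional estimate on each perpendicular line, integrated over `s` by Tonelli, gives the
bound. -/
theorem lintegral_armMeasure_le (f : 𝓢(Plane, ℂ)) (θ : ℝ) {ε : ℝ} (hε : 0 < ε) :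
    ∫⁻ x, ENNReal.ofReal (‖f x‖ ^ 2) ∂(armMeasure θ) ≤
      ∫⁻ x, ENNReal.ofReal (energyDensity ε f x) := by
  have hf := f.continuous
  have he := continuous_energyDensity ε f
  set v := unitVec (θ + Real.pi / 2)
  rw [armMeasure, lintegral_map (by fun_prop) (by fun_prop),
    ← (measurePreserving_rotatedBasis θ).lintegral_comp (by fun_prop), Measure.volume_eq_prod,
    lintegral_prod _ (by fun_prop)]
  refine (setLIntegral_le_lintegral _ _).trans (lintegral_mono fun s => ?_)
  have hline : ∀ t : ℝ, HasDerivAt (fun t : ℝ => s • unitVec θ + t • v) v t := fun t => by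
    simpa using ((hasDerivAt_id t).smul_const v).const_add (s • unitVec θ)
  have hd : ∀ t : ℝ, HasDerivAt (fun t : ℝ => f (s • unitVec θ + t • v))
      ((∂_{v} f : 𝓢(Plane, ℂ)) (s • unitVec θ + t • v)) t := fun t =>
    (f.hasFDerivAt _).comp_hasDerivAt t (hline t)
  have hlim : Filter.Tendsto (fun t : ℝ => f (s • unitVec θ + t • v)) Filter.atTop (nhds 0) := by
    refine f.tendsto_cocompact.comp (tendsto_norm_atTop_iff_cobounded.1 ?_ |>.mono_right
      (Metric.cobounded_eq_cocompact (α := Plane)).le)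
    refine Filter.tendsto_atTop_mono (f := fun t : ℝ => t - ‖s • unitVec θ‖) (fun t => ?_)
      (Filter.tendsto_atTop_add_const_right _ _ Filter.tendsto_id)
    have h1 : ‖t • v‖ = |t| := by rw [norm_smul, norm_unitVec, mul_one, Real.norm_eq_abs]
    have h2 := norm_sub_le (s • unitVec θ + t • v) (s • unitVec θ)
    rw [add_sub_cancel_left, h1] at h2
    linarith [le_abs_self t]
  have h := ofReal_sq_norm_le_lintegral_of_hasDerivAt hd
    ((∂_{v} f : 𝓢(Plane, ℂ)).continuous.comp (by fun_prop)) hlim hε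
  simp only [zero_smul, add_zero] at h
  refine h.trans (lintegral_mono fun t => ENNReal.ofReal_le_ofReal ?_)
  unfold energyDensity
  gcongr
  exact sq_norm_lineDerivOp_unitVec_le f _ _

theorem ofReal_sq_norm_toLp (f : 𝓢(Plane, ℂ)) (m : Measure Plane) [m.HasTemperateGrowth] :
    ENNReal.ofReal (‖f.toLp 2 m‖ ^ 2) = ∫⁻ x, ENNReal.ofReal (‖f x‖ ^ 2) ∂m := by
  rw [SchwartzMap.norm_toLp, ENNReal.ofReal_pow ENNReal.toReal_nonneg,
    ENNReal.ofReal_toReal (f.eLpNorm_lt_top 2 m).ne,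
    eLpNorm_eq_lintegral_rpow_enorm_toReal (by norm_num) (by norm_num)]
  simp only [ENNReal.toReal_ofNat, one_div]
  rw [← ENNReal.rpow_natCast, ← ENNReal.rpow_mul]
  norm_num

theorem sq_norm_toLp_starMeasure_le {N : ℕ} (β : Fin N → ℝ) (f : 𝓢(Plane, ℂ)) {ε : ℝ}
    (hε : 0 < ε) :
    ‖f.toLp 2 (starMeasure β)‖ ^ 2 ≤ N *
      (ε * (‖(∂_{planeBasis 0} f : 𝓢(Plane, ℂ)).toLp 2 (volume : Measure Plane)‖ ^ 2 +
          ‖(∂_{planeBasis 1} f : 𝓢(Plane, ℂ)).toLp 2 (volume : Measure Plane)‖ ^ 2)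
        + ε⁻¹ * ‖f.toLp 2 (volume : Measure Plane)‖ ^ 2) := by
  have hf := f.continuous
  have h0 := (∂_{planeBasis 0} f : 𝓢(Plane, ℂ)).continuous
  have h1 := (∂_{planeBasis 1} f : 𝓢(Plane, ℂ)).continuous
  have henergy : ∫⁻ x, ENNReal.ofReal (energyDensity ε f x) = ENNReal.ofReal
      (ε * (‖(∂_{planeBasis 0} f : 𝓢(Plane, ℂ)).toLp 2 (volume : Measure Plane)‖ ^ 2 +
          ‖(∂_{planeBasis 1} f : 𝓢(Plane, ℂ)).toLp 2 (volume : Measure Plane)‖ ^ 2)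
        + ε⁻¹ * ‖f.toLp 2 (volume : Measure Plane)‖ ^ 2) := by
    rw [ENNReal.ofReal_add (by positivity) (by positivity), ENNReal.ofReal_mul hε.le,
      ENNReal.ofReal_mul (by positivity), ENNReal.ofReal_add (by positivity) (by positivity),
      ofReal_sq_norm_toLp, ofReal_sq_norm_toLp, ofReal_sq_norm_toLp,
      ← lintegral_add_left (by fun_prop), ← lintegral_const_mul _ (by fun_prop),
      ← lintegral_const_mul _ (by fun_prop), ← lintegral_add_left (by fun_prop)]
    refine lintegral_congr fun x => ?_
    rw [energyDensity, ENNReal.ofReal_add (by positivity) (by positivity),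
      ENNReal.ofReal_mul hε.le, ENNReal.ofReal_mul (by positivity),
      ENNReal.ofReal_add (by positivity) (by positivity)]
  rw [← ENNReal.ofReal_le_ofReal_iff (by positivity), ofReal_sq_norm_toLp,
    ENNReal.ofReal_mul (by positivity), ← henergy, starMeasure, lintegral_finsetSum_measure]
  refine (Finset.sum_le_card_nsmul _ _ _ fun j _ => lintegral_armMeasure_le f _ hε).trans ?_
  simp

/-! ### Splitting an angle adds an arm -/

/-- The inserted arm has index `j.succ`, since it comes after the first part of the split angle.
Deleting this index by `succAbove` recovers exactly the old arms. -/
theorem starMeasure_mono_of_split {N : ℕ} {β : Fin N → ℝ} {j : Fin N} {β' : Fin (N + 1) → ℝ}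
    (hbefore : ∀ i : Fin N, i < j → β' i.castSucc = β i)
    (hsplit : β' j.castSucc + β' j.succ = β j)
    (hafter : ∀ i : Fin N, j < i → β' i.succ = β i) :
    starMeasure β ≤ starMeasure β' := by
  have hval : ∀ k, β' (j.succ.succAbove k) = β k - if k = j then β' j.succ else 0 := fun k => by
    rcases lt_trichotomy k j with h | rfl | h
    · rw [Fin.succAbove_of_castSucc_lt _ _ (Fin.castSucc_lt_succ_iff.2 h.le), hbefore k h,
        if_neg h.ne, sub_zero]
    · rw [Fin.succAbove_of_castSucc_lt _ _ Fin.castSucc_lt_succ, if_pos rfl, ← hsplit,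
        add_sub_cancel_right]
    · rw [Fin.succAbove_of_lt_succ _ _ (Fin.succ_lt_succ_iff.2 h), hafter k h, if_neg h.ne',
        sub_zero]
  have hlt : ∀ i, j.succ < j.succ.succAbove i ↔ j < i := fun i => by
    rw [Fin.lt_succAbove_iff_le_castSucc, Fin.le_castSucc_iff, Fin.succ_lt_succ_iff]
  -- For `j < i` the partial sum contains the deleted entry `β' j.succ`, which cancels the deficit
  -- in entry `j` recorded by `hval`; for `i ≤ j` neither occurs.
  have hangle : ∀ i, armAngle β' (j.succ.succAbove i) = armAngle β i := fun i => by
    have hsum : ∀ {n : ℕ} (b : Fin n → ℝ) (l : Fin n),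
        armAngle b l = ∑ k, if k < l then b k else 0 := fun b l => by
      rw [armAngle, ← Finset.sum_filter]
      congr 1
      ext k
      simp
    rw [hsum, hsum, Fin.sum_univ_succAbove _ j.succ]
    simp only [Fin.succAbove_lt_succAbove_iff, hval, hlt]
    have hite : ∀ k, (if k < i then β k - (if k = j then β' j.succ else 0) else 0) =
        (if k < i then β k else 0) - if k = j then (if j < i then β' j.succ else 0) else 0 :=
      fun k => by
        by_cases hk : k = j
        · subst hk
          by_cases hi : k < i <;> simp [hi]
        · simp [hk]
    simp only [hite, Finset.sum_sub_distrib, Finset.sum_ite_eq', Finset.mem_univ, if_true]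
    ring
  rw [starMeasure, starMeasure, Fin.sum_univ_succAbove _ j.succ]
  simp only [hangle]
  exact Measure.le_add_left le_rfl

/-! ### Completeness of `H¹` and density of the Schwartz functions -/

theorem sobolevH1.sq_norm_eq (ψ : sobolevH1) :
    ‖ψ‖ ^ 2 = ‖sobolevH1.toL2 ψ‖ ^ 2 + ‖sobolevH1.grad ψ‖ ^ 2 :=
  WithLp.prod_norm_sq_eq_of_L2 _

theorem sobolevH1.norm_toL2_le (ψ : sobolevH1) : ‖sobolevH1.toL2 ψ‖ ≤ ‖ψ‖ := by
  refine le_of_sq_le_sq ?_ (norm_nonneg _)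
  rw [sobolevH1.sq_norm_eq]
  exact le_add_of_nonneg_right (by positivity)

theorem sobolevH1.norm_grad_le (ψ : sobolevH1) : ‖sobolevH1.grad ψ‖ ≤ ‖ψ‖ := by
  refine le_of_sq_le_sq ?_ (norm_nonneg _)
  rw [sobolevH1.sq_norm_eq]
  exact le_add_of_nonneg_left (by positivity)

theorem sobolevH1.continuous_toL2 : Continuous sobolevH1.toL2 :=
  (sobolevH1.toL2.mkContinuous 1 fun ψ => by simpa using sobolevH1.norm_toL2_le ψ).continuous

theorem sobolevH1.continuous_grad : Continuous sobolevH1.grad :=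
  (sobolevH1.grad.mkContinuous 1 fun ψ => by simpa using sobolevH1.norm_grad_le ψ).continuous

/-- Distributional differentiation and the embedding of L² are continuous into tempered
distributions, so the defining equations are closed conditions. -/
theorem isClosed_sobolevH1 :
    IsClosed (sobolevH1 : Set (WithLp 2 (L2Plane × PiLp 2 (fun _ : Fin 2 => L2Plane)))) := by
  have h : (sobolevH1 : Set (WithLp 2 (L2Plane × PiLp 2 (fun _ : Fin 2 => L2Plane)))) =
      ⋂ i : Fin 2, {p | lineDerivOpCLM ℂ 𝓢'(Plane, ℂ) (planeBasis i)
          (Lp.toTemperedDistributionCLM ℂ (volume : Measure Plane) 2 p.fst) =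
        Lp.toTemperedDistributionCLM ℂ (volume : Measure Plane) 2 (p.snd i)} := by
    ext p
    simp only [Set.mem_iInter]
    rfl
  rw [h]
  refine isClosed_iInter fun i => isClosed_eq ?_ ?_
  · exact (ContinuousLinearMap.continuous _).comp ((ContinuousLinearMap.continuous _).comp
      (WithLp.prod_continuous_ofLp 2 _ _).fst)
  · refine (ContinuousLinearMap.continuous _).comp ?_
    exact (continuous_apply i).comp ((PiLp.continuous_ofLp 2 _).comp
      (WithLp.prod_continuous_ofLp 2 _ _).snd)

instance : CompleteSpace sobolevH1 := isClosed_sobolevH1.completeSpace_coe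

/-- Pointwise complex conjugation of a Schwartz function. -/
def schwartzConj (f : 𝓢(Plane, ℂ)) : 𝓢(Plane, ℂ) :=
  f.postcompCLM (Complex.conjCLE : ℂ →L[ℝ] ℂ)

theorem schwartzConj_apply (f : 𝓢(Plane, ℂ)) (x : Plane) :
    schwartzConj f x = starRingEnd ℂ (f x) := rfl

theorem lineDerivOp_schwartzConj (f : 𝓢(Plane, ℂ)) (v : Plane) :
    ∂_{v} (schwartzConj f) = schwartzConj (∂_{v} f) := by
  ext x
  have h : HasFDerivAt (schwartzConj f) ((Complex.conjCLE : ℂ →L[ℝ] ℂ) ∘L fderiv ℝ f x) x :=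
    (Complex.conjCLE : ℂ →L[ℝ] ℂ).hasFDerivAt.comp x (f.hasFDerivAt x)
  rw [schwartzConj_apply, SchwartzMap.lineDerivOp_apply_eq_fderiv, h.fderiv]
  rfl

theorem inner_toLp_schwartzConj (f : 𝓢(Plane, ℂ)) (u : L2Plane) :
    ⟪(schwartzConj f).toLp 2 volume, u⟫_ℂ = Lp.toTemperedDistribution u f := by
  rw [Lp.toTemperedDistribution_apply, L2.inner_def]
  refine integral_congr_ae ?_
  filter_upwards [(schwartzConj f).coeFn_toLp 2 volume] with x hx
  rw [hx, schwartzConj_apply, RCLike.inner_apply, Complex.conj_conj, smul_eq_mul, mul_comm]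

/-- The operator `1 - Δ` is the Fourier multiplier with symbol `1 + ‖2πx‖²`, whose reciprocal also
has temperate growth and so gives an inverse multiplier. -/
theorem TemperedDistribution.eq_zero_of_eq_laplacian {u : 𝓢'(Plane, ℂ)}
    (h : u = Laplacian.laplacian u) : u = 0 := by
  have hsq : (fun x : Plane => ((‖x‖ ^ 2 : ℝ) : ℂ)).HasTemperateGrowth := by fun_prop
  have hone : (fun _ : Plane => (1 : ℂ)).HasTemperateGrowth := by fun_prop
  have hmul : (((2 * Real.pi) ^ 2 : ℂ) • fun x : Plane => ((‖x‖ ^ 2 : ℝ) : ℂ)).HasTemperateGrowth := by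
    have : (fun x : Plane => ((2 * Real.pi) ^ 2 : ℂ) * ((‖x‖ ^ 2 : ℝ) : ℂ)).HasTemperateGrowth := by
      fun_prop
    exact this
  have hinv : (fun x : Plane =>
      (((1 + ‖(2 * Real.pi) • x‖ ^ 2) ^ (-1 : ℝ) : ℝ) : ℂ)).HasTemperateGrowth := by
    have h1 : (fun x : Plane => (1 + ‖x‖ ^ 2) ^ (-1 : ℝ)).HasTemperateGrowth := by fun_prop
    have h2 : (fun x : Plane => (2 * Real.pi) • x).HasTemperateGrowth := by fun_prop
    have h3 := h1.comp h2
    fun_prop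
  have hzero : fourierMultiplierCLM ℂ ((fun _ : Plane => (1 : ℂ)) +
      ((2 * Real.pi) ^ 2 : ℂ) • fun x : Plane => ((‖x‖ ^ 2 : ℝ) : ℂ)) u = 0 := by
    have hadd : ∀ v, fourierMultiplierCLM ℂ ((fun _ : Plane => (1 : ℂ)) +
        ((2 * Real.pi) ^ 2 : ℂ) • fun x : Plane => ((‖x‖ ^ 2 : ℝ) : ℂ)) v = 
        fourierMultiplierCLM ℂ (fun _ : Plane => (1 : ℂ)) v +
        fourierMultiplierCLM ℂ (((2 * Real.pi) ^ 2 : ℂ) • fun x : Plane => ((‖x‖ ^ 2 : ℝ) : ℂ)) v := by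
      intro v
      simp only [fourierMultiplierCLM_apply, smulLeftCLM_add hone hmul,
        add_apply, FourierTransform.fourierInv_add]
    rw [hadd, fourierMultiplierCLM_smul hsq, fourierMultiplierCLM_const, one_smul]
    rw [laplacian_eq_fourierMultiplierCLM] at h
    simp only [smul_apply, ContinuousLinearMap.id_apply]
    nth_rw 1 [h]
    ext f
    simp
  have hid := congrArg (fourierMultiplierCLM ℂ (fun x : Plane =>
      (((1 + ‖(2 * Real.pi) • x‖ ^ 2) ^ (-1 : ℝ) : ℝ) : ℂ))) hzero
  rw [map_zero, fourierMultiplierCLM_fourierMultiplierCLM_apply (hone.add hmul) hinv] at hid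
  have hprod : ((fun _ : Plane => (1 : ℂ)) +
      ((2 * Real.pi) ^ 2 : ℂ) • fun x : Plane => ((‖x‖ ^ 2 : ℝ) : ℂ)) * (fun x : Plane =>
      (((1 + ‖(2 * Real.pi) • x‖ ^ 2) ^ (-1 : ℝ) : ℝ) : ℂ)) = fun _ => 1 := by
    ext x
    have hpos : (1 + ‖(2 * Real.pi) • x‖ ^ 2) ≠ 0 := by positivity
    have hcast : (1 : ℂ) + (2 * Real.pi) ^ 2 * ((‖x‖ ^ 2 : ℝ) : ℂ) =
        ((1 + ‖(2 * Real.pi) • x‖ ^ 2 : ℝ) : ℂ) := by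
      rw [norm_smul, mul_pow, Real.norm_of_nonneg Real.two_pi_pos.le]
      push_cast
      ring
    simp only [Pi.mul_apply, Pi.add_apply, Pi.smul_apply, smul_eq_mul, hcast]
    rw [← Complex.ofReal_mul, Real.rpow_neg_one, mul_inv_cancel₀ hpos, Complex.ofReal_one]
  rw [hprod, fourierMultiplierCLM_const, one_smul] at hid
  exact hid

theorem denseRange_of_orthogonal_eq_zero {V E : Type*} [AddCommGroup V] [Module ℂ V]
    [NormedAddCommGroup E] [InnerProductSpace ℂ E] [CompleteSpace E] (T : V → E)
    (hadd : ∀ v w, T (v + w) = T v + T w) (hsmul : ∀ (c : ℂ) v, T (c • v) = c • T v)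
    (h : ∀ p, (∀ v, ⟪T v, p⟫_ℂ = 0) → p = 0) : DenseRange T := by
  let L : V →ₗ[ℂ] E := ⟨⟨T, hadd⟩, hsmul⟩
  have htop : (LinearMap.range L).topologicalClosure = ⊤ := by
    rw [Submodule.topologicalClosure_eq_top_iff, Submodule.eq_bot_iff]
    exact fun p hp => h p fun v =>
      (Submodule.mem_orthogonal _ _).1 hp _ (LinearMap.mem_range_self L v)
  exact fun x => by
    have hx : x ∈ (LinearMap.range L).topologicalClosure := htop ▸ Submodule.mem_top
    simpa using! hx

/-- An element of H¹ orthogonal to all Schwartz functions satisfies `u = Δu` weakly, hence vanishes.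
Testing with conjugates turns the inner product, antilinear in its first slot, into the
distributional pairing. -/
theorem denseRange_schwartzToH1 : DenseRange schwartzToH1 := by
  refine denseRange_of_orthogonal_eq_zero schwartzToH1 (map_add _) (map_smul _)
    fun p horth => ?_
  apply sobolevH1.toL2_injective
  rw [map_zero]
  refine LinearMap.ker_eq_bot'.mp (Lp.ker_toTemperedDistributionCLM_eq_bot
    (F := ℂ) (μ := (volume : Measure Plane)) (p := 2)) _ ?_
  refine TemperedDistribution.eq_zero_of_eq_laplacian ?_
  rw [TemperedDistribution.laplacian_eq_sum (EuclideanSpace.basisFun (Fin 2) ℝ)]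
  ext f
  have h := horth (schwartzConj f)
  have h1 : ⟪schwartzToH1 (schwartzConj f), p⟫_ℂ =
      ⟪(schwartzConj f).toLp 2 volume, sobolevH1.toL2 p⟫_ℂ +
      ⟪WithLp.toLp 2 fun i => (∂_{planeBasis i} (schwartzConj f) : 𝓢(Plane, ℂ)).toLp 2 volume,
        sobolevH1.grad p⟫_ℂ := rfl
  have hgrad : ∀ i, Lp.toTemperedDistribution (sobolevH1.grad p i) =
    ∂_{planeBasis i} (Lp.toTemperedDistribution (sobolevH1.toL2 p)) := fun i => (p.2 i).symm
  rw [h1, PiLp.inner_apply] at h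
  simp only [lineDerivOp_schwartzConj, inner_toLp_schwartzConj, hgrad] at h
  have hb : ∀ i, EuclideanSpace.basisFun (Fin 2) ℝ i = planeBasis i := fun i => by
    simp [planeBasis]
  simp only [hb, Fin.sum_univ_two] at h ⊢
  change Lp.toTemperedDistribution (sobolevH1.toL2 p) f = _
  rw [eq_neg_of_add_eq_zero_left h]
  simp only [TemperedDistribution.lineDerivOp_apply_apply, map_neg, neg_add_rev, neg_neg,
    add_apply]
  exact add_comm _ _

/-! ### The trace map -/

theorem sq_norm_toLp_starMeasure_le_grad {N : ℕ} (β : Fin N → ℝ) (f : 𝓢(Plane, ℂ)) {ε : ℝ}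
    (hε : 0 < ε) :
    ‖f.toLp 2 (starMeasure β)‖ ^ 2 ≤ N * (ε * ‖sobolevH1.grad (schwartzToH1 f)‖ ^ 2
        + ε⁻¹ * ‖sobolevH1.toL2 (schwartzToH1 f)‖ ^ 2) := by
  refine (sq_norm_toLp_starMeasure_le β f hε).trans (le_of_eq ?_)
  have hgrad : ‖sobolevH1.grad (schwartzToH1 f)‖ ^ 2 =
      ∑ i, ‖(∂_{planeBasis i} f : 𝓢(Plane, ℂ)).toLp 2 (volume : Measure Plane)‖ ^ 2 :=
    PiLp.norm_sq_eq_of_L2 _ _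
  rw [hgrad, Fin.sum_univ_two]
  rfl

theorem norm_toLp_starMeasure_le {N : ℕ} (β : Fin N → ℝ) (f : 𝓢(Plane, ℂ)) :
    ‖f.toLp 2 (starMeasure β)‖ ≤ √N * ‖schwartzToH1 f‖ := by
  refine le_of_sq_le_sq ?_ (by positivity)
  rw [mul_pow, Real.sq_sqrt N.cast_nonneg, sobolevH1.sq_norm_eq, add_comm]
  simpa using sq_norm_toLp_starMeasure_le_grad β f one_pos

/-- Density and the norm bound are what `LinearMap.extendOfNorm` needs in order to take the
prescribed values. -/
theorem sobolevTrace_schwartzToH1 {N : ℕ} (β : Fin N → ℝ) (f : 𝓢(Plane, ℂ)) :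
    sobolevTrace (starMeasure β) (schwartzToH1 f) = f.toLp 2 (starMeasure β) :=
  LinearMap.extendOfNorm_eq denseRange_schwartzToH1 ⟨√N, norm_toLp_starMeasure_le β⟩ f

theorem sq_norm_sobolevTrace_le {N : ℕ} (β : Fin N → ℝ) (ψ : sobolevH1) {ε : ℝ} (hε : 0 < ε) :
    ‖sobolevTrace (starMeasure β) ψ‖ ^ 2 ≤
      N * (ε * ‖sobolevH1.grad ψ‖ ^ 2 + ε⁻¹ * ‖sobolevH1.toL2 ψ‖ ^ 2) := by
  have h1 := sobolevH1.continuous_grad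
  have h2 := sobolevH1.continuous_toL2
  have h3 := (sobolevTrace (starMeasure β)).continuous
  refine denseRange_schwartzToH1.induction_on (p := fun ψ => ‖sobolevTrace (starMeasure β) ψ‖ ^ 2 ≤
      N * (ε * ‖sobolevH1.grad ψ‖ ^ 2 + ε⁻¹ * ‖sobolevH1.toL2 ψ‖ ^ 2)) ψ
    (isClosed_le (by fun_prop) (by fun_prop)) fun f => ?_
  rw [sobolevTrace_schwartzToH1]
  exact sq_norm_toLp_starMeasure_le_grad β f hε

theorem norm_sobolevTrace_mono {N M : ℕ} {β : Fin N → ℝ} {β' : Fin M → ℝ}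
    (h : starMeasure β ≤ starMeasure β') (ψ : sobolevH1) :
    ‖sobolevTrace (starMeasure β) ψ‖ ≤ ‖sobolevTrace (starMeasure β') ψ‖ := by
  have h2 := (sobolevTrace (starMeasure β')).continuous
  have h3 := (sobolevTrace (starMeasure β)).continuous
  refine denseRange_schwartzToH1.induction_on
    (p := fun ψ => ‖sobolevTrace (starMeasure β) ψ‖ ≤ ‖sobolevTrace (starMeasure β') ψ‖) ψ
    (isClosed_le (by fun_prop) (by fun_prop)) fun f => ?_
  rw [sobolevTrace_schwartzToH1, sobolevTrace_schwartzToH1, SchwartzMap.norm_toLp,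
    SchwartzMap.norm_toLp]
  exact ENNReal.toReal_mono (f.eLpNorm_lt_top 2 _).ne (eLpNorm_mono_measure _ h)

/-! ### The form of the star graph -/

/-- The element of `H¹(ℝ²)` underlying an element of the form domain. -/
def formDomainEquiv (γ : ℝ) (m : Measure Plane) [m.HasTemperateGrowth] :
    (schrodingerForm γ m).domain ≃ₗ[ℂ] sobolevH1 :=
  (LinearEquiv.ofInjective sobolevH1.toL2 sobolevH1.toL2_injective).symm

theorem toL2_formDomainEquiv (γ : ℝ) (m : Measure Plane) [m.HasTemperateGrowth]
    (ψ : (schrodingerForm γ m).domain) :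
    sobolevH1.toL2 (formDomainEquiv γ m ψ) = ψ :=
  congrArg Subtype.val
    ((LinearEquiv.ofInjective sobolevH1.toL2 sobolevH1.toL2_injective).apply_symm_apply ψ)

theorem schrodingerForm_form_apply (γ : ℝ) (m : Measure Plane) [m.HasTemperateGrowth]
    (φ ψ : (schrodingerForm γ m).domain) :
    (schrodingerForm γ m).form φ ψ =
      ⟪sobolevH1.grad (formDomainEquiv γ m φ), sobolevH1.grad (formDomainEquiv γ m ψ)⟫_ℂ
      - (γ : ℂ) * ⟪sobolevTrace m (formDomainEquiv γ m φ), sobolevTrace m (formDomainEquiv γ m ψ)⟫_ℂ :=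
  rfl

theorem schrodingerForm_quad (γ : ℝ) (m : Measure Plane) [m.HasTemperateGrowth]
    (ψ : (schrodingerForm γ m).domain) :
    (schrodingerForm γ m).quad ψ = ‖sobolevH1.grad (formDomainEquiv γ m ψ)‖ ^ 2
      - γ * ‖sobolevTrace m (formDomainEquiv γ m ψ)‖ ^ 2 := by
  rw [SesqForm.quad, schrodingerForm_form_apply, Complex.sub_re, Complex.re_ofReal_mul]
  have h1 := inner_self_eq_norm_sq (𝕜 := ℂ) (sobolevH1.grad (formDomainEquiv γ m ψ))
  have h2 := inner_self_eq_norm_sq (𝕜 := ℂ) (sobolevTrace m (formDomainEquiv γ m ψ))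
  rw [← h1, ← h2]
  rfl

theorem exists_half_sq_norm_grad_le_schrodingerForm_quad {γ : ℝ} (hγ : 0 ≤ γ) {N : ℕ}
    (β : Fin N → ℝ) :
    ∃ C : ℝ, 0 ≤ C ∧ ∀ ψ : (schrodingerForm γ (starMeasure β)).domain,
      2⁻¹ * ‖sobolevH1.grad (formDomainEquiv γ (starMeasure β) ψ)‖ ^ 2 - C * ‖(ψ : L2Plane)‖ ^ 2 ≤
        (schrodingerForm γ (starMeasure β)).quad ψ := by
  -- Chosen so that `γ * N * ε ≤ 1/2`; the `+ 1` covers `γ * N = 0`.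
  set ε : ℝ := (2 * (γ * N + 1))⁻¹ with hε
  have hpos : 0 < ε := by positivity
  refine ⟨γ * N * ε⁻¹, by positivity, fun ψ => ?_⟩
  rw [schrodingerForm_quad]
  have h := mul_le_mul_of_nonneg_left
    (sq_norm_sobolevTrace_le β (formDomainEquiv γ (starMeasure β) ψ) hpos) hγ
  rw [toL2_formDomainEquiv] at h
  have hle : γ * N * ε ≤ 2⁻¹ := by
    rw [hε, mul_inv, mul_left_comm, ← div_eq_mul_inv]
    exact mul_le_of_le_one_right (by norm_num) (div_le_one_of_le₀ (by linarith) (by positivity))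
  have h2 := mul_le_mul_of_nonneg_right hle
    (sq_nonneg ‖sobolevH1.grad (formDomainEquiv γ (starMeasure β) ψ)‖)
  linarith

theorem schrodingerForm_starMeasure_isClosedSemibounded {γ : ℝ} (hγ : 0 ≤ γ) {N : ℕ}
    (β : Fin N → ℝ) : (schrodingerForm γ (starMeasure β)).IsClosedSemibounded where
  dense := by
    refine (SchwartzMap.denseRange_toLpCLM (E := Plane) (F := ℂ) (p := 2)
      (μ := (volume : Measure Plane)) ENNReal.ofNat_ne_top).mono ?_
    rintro _ ⟨f, rfl⟩
    exact ⟨schwartzToH1 f, rfl⟩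
  symm φ ψ := by
    rw [schrodingerForm_form_apply, schrodingerForm_form_apply, map_sub, map_mul,
      inner_conj_symm, inner_conj_symm, Complex.conj_ofReal]
  bounded_below := by
    obtain ⟨C, -, hC⟩ := exists_half_sq_norm_grad_le_schrodingerForm_quad hγ β
    refine ⟨-C, fun ψ => le_trans ?_ (hC ψ)⟩
    have : 0 ≤ 2⁻¹ * ‖sobolevH1.grad (formDomainEquiv γ (starMeasure β) ψ)‖ ^ 2 := by positivity
    linarith
  closed u ψ hu hq := by
    let e := formDomainEquiv γ (starMeasure β)
    have he : ∀ v, sobolevH1.toL2 (e v) = v := toL2_formDomainEquiv γ (starMeasure β)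
    obtain ⟨C, hC0, hC⟩ := exists_half_sq_norm_grad_le_schrodingerForm_quad hγ β
    have hdiff : Filter.Tendsto (fun p : ℕ × ℕ => ‖(u p.1 : L2Plane) - u p.2‖)
        Filter.atTop (nhds 0) := by
      have := ((hu.comp Filter.tendsto_fst).sub (hu.comp Filter.tendsto_snd)).norm
      rw [Filter.prod_atTop_atTop_eq] at this
      simpa using this
    -- Form-Cauchy plus L²-convergent implies H¹-Cauchy: the coercivity bound `hC` is doubled, and
    -- the extra 1 is the L² part of the H¹ norm.
    have hnorm : ∀ p : ℕ × ℕ, ‖e (u p.1) - e (u p.2)‖ ^ 2 ≤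
        2 * (schrodingerForm γ (starMeasure β)).quad (u p.1 - u p.2) +
          (2 * C + 1) * ‖(u p.1 : L2Plane) - u p.2‖ ^ 2 := fun p => by
      rw [← map_sub, sobolevH1.sq_norm_eq, he]
      have h := hC (u p.1 - u p.2)
      rw [Submodule.coe_sub] at h ⊢
      linarith
    have hlim : Filter.Tendsto
        (fun p : ℕ × ℕ => ‖e (u p.1) - e (u p.2)‖ ^ 2)
        Filter.atTop (nhds 0) := by
      refine squeeze_zero (fun _ => by positivity) hnorm ?_
      simpa using (hq.const_mul 2).add ((hdiff.pow 2).const_mul (2 * C + 1))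
    have hcauchy : CauchySeq fun n => e (u n) := by
      rw [cauchySeq_iff_tendsto_dist_atTop_0]
      have h := hlim.sqrt
      simpa [dist_eq_norm, Real.sqrt_sq] using h
    obtain ⟨w, hw⟩ := cauchySeq_tendsto_of_complete hcauchy
    -- The H¹ limit is identified through uniqueness of limits in L²; the form, being continuous on
    -- H¹, then converges.
    have hψ : sobolevH1.toL2 w = ψ := by
      refine tendsto_nhds_unique ((sobolevH1.continuous_toL2.tendsto w).comp hw) ?_
      simpa [Function.comp_def, he] using hu
    have hmem : ψ ∈ LinearMap.range sobolevH1.toL2 := ⟨w, hψ⟩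
    have hwψ : e ⟨ψ, hmem⟩ = w := by
      apply sobolevH1.toL2_injective
      rw [he, hψ]
    refine ⟨hmem, ?_⟩
    have hquad : ∀ n, (schrodingerForm γ (starMeasure β)).quad (u n - ⟨ψ, hmem⟩) =
        ‖sobolevH1.grad (e (u n) - w)‖ ^ 2
        - γ * ‖sobolevTrace (starMeasure β) (e (u n) - w)‖ ^ 2 := fun n => by
      rw [← hwψ, ← map_sub]
      exact schrodingerForm_quad _ _ _
    have hcont : Continuous fun v : sobolevH1 => ‖sobolevH1.grad v‖ ^ 2
        - γ * ‖sobolevTrace (starMeasure β) v‖ ^ 2 := by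
      have h1 := sobolevH1.continuous_grad
      have h3 := (sobolevTrace (starMeasure β)).continuous
      fun_prop
    have hsub : Filter.Tendsto (fun n => e (u n) - w) Filter.atTop (nhds 0) := by
      simpa using hw.sub_const w
    have h := (hcont.tendsto 0).comp hsub
    simp only [map_zero, norm_zero, ne_eq, OfNat.ofNat_ne_zero, not_false_eq_true, zero_pow,
      mul_zero, sub_zero] at h
    exact h.congr fun n => (hquad n).symm

/-! ### Comparison of the two forms -/

theorem mainTheorem8 (γ : ℝ) (hγ : 0 ≤ γ) (N : ℕ) (hN : 2 ≤ N)
    (β : Fin N → ℝ) (hβ : IsAngleSeq β) (j : Fin N)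
    (β' : Fin (N + 1) → ℝ) (hβ' : IsAngleSeq β')
    (hbefore : ∀ i : Fin N, i < j → β' i.castSucc = β i)
    (hsplit : β' j.castSucc + β' j.succ = β j)
    (hafter : ∀ i : Fin N, j < i → β' i.succ = β i) :
    FormGE (starHamiltonian γ β) (starHamiltonian γ β') := by
  refine ⟨schrodingerForm γ (starMeasure β), schrodingerForm γ (starMeasure β'),
    schrodingerForm_starMeasure_isClosedSemibounded hγ β,
    schrodingerForm_starMeasure_isClosedSemibounded hγ β', rfl, rfl, le_rfl, fun ψ => ?_⟩
  have hmono := norm_sobolevTrace_mono (starMeasure_mono_of_split hbefore hsplit hafter)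
    (formDomainEquiv γ (starMeasure β) ψ)
  -- The two domains agree definitionally and `formDomainEquiv` does not depend on the measure, so
  -- both forms are evaluated at the same element of H¹.
  have hquad : (schrodingerForm γ (starMeasure β')).quad
      (show (schrodingerForm γ (starMeasure β')).domain from ψ) =
      ‖sobolevH1.grad (formDomainEquiv γ (starMeasure β) ψ)‖ ^ 2
      - γ * ‖sobolevTrace (starMeasure β') (formDomainEquiv γ (starMeasure β) ψ)‖ ^ 2 :=
    schrodingerForm_quad γ (starMeasure β') _
  refine hquad.le.trans ?_
  rw [schrodingerForm_quad]
  gcongr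

end
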